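/- Let $K$ be a field, let $m\ge 0$, $d$ and $n$ be integers with $d\geq 1$ and $c:=n-m\ge 3$, let $S=K[x_0,\dots,x_n]$, and let $I\subset S$ be a homogeneous ideal such that $T=S/I$ is Cohen–Macaulay of (projective) dimension $m$, that is, of Krull dimension $m+1$ and codimension $c$. Let $\beta_{i,i+j}=\dim_K \operatorname{Tor}^S_i(T,K)_{i+j}$ be the graded Betti numbers of $T$ (the number of summands $S(-i-j)$ in step $i$ of the minimal graded free resolution of $T$ over $S$), and assume that the Betti table of $T$, with entry $\beta_{i,i+j}$ in column $i$ and row $j$, has a (maximal) $(c,d)$-Koszul tail. This means that in columns $0\le i\le c$ and rows $0\le j\le d$ the only nonzero entries are $$\beta_{0,0}=1,\qquad \beta_{i,i+d}=\binom{c}{i}\quad (1\le i\le c).$$ Let $A=T/(\ell_0,\dots,\ell_m)T$ be an Artinian reduction of $T$, where $\ell_0,\dots,\ell_m\in S$ is any $T$-regular sequence of linear forms (for instance general linear forms, if $K$ is infinite). Then $A$ is Artinian and fails the Weak Lefschetz Property: there is no linear form $\ell$ such that the multiplication $A_i\xrightarrow{\ \cdot \ell\ }A_{i+1}$ is injective or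 surjective for every $i\ge 0$. -/

import Mathlib

open MvPolynomial

attribute [local instance] MvPolynomial.gradedAlgebra

/-- A Noetherian local ring is Cohen-Macaulay if its maximal ideal contains a regular sequence
whose length is the Krull dimension (that is, depth equals dimension). -/
def IsCohenMacaulayLocal (R : Type*) [CommRing R] [IsLocalRing R] : Prop :=
  IsNoetherianRing R ∧ ∃ rs : List R, (∀ r ∈ rs, r ∈ IsLocalRing.maximalIdeal R) ∧
    RingTheory.Sequence.IsRegular R rs ∧ (rs.length : WithBot ℕ∞) = ringKrullDim R

/-- A Noetherian ring is Cohen-Macaulay if all its localizations at primes are. -/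
def IsCohenMacaulay (R : Type*) [CommRing R] : Prop :=
  IsNoetherianRing R ∧
    ∀ (p : Ideal R) [p.IsPrime], IsCohenMacaulayLocal (Localization.AtPrime p)

/-- The degree `i` component of the standard graded algebra `K[x]/J`, for a homogeneous ideal `J`:
the classes of the forms of degree `i`. -/
noncomputable def gradedPiece {σ K : Type*} [Field K] (J : Ideal (MvPolynomial σ K)) (i : ℕ) :
    Submodule K (MvPolynomial σ K ⧸ J) :=
  (homogeneousSubmodule σ K i).map (Ideal.Quotient.mkₐ K J).toLinearMap

/-- Multiplication by the linear form `l`, from degree `i` to degree `i + 1` of `K[x]/J`, has full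
rank: it is injective or surjective. -/
def MulHasFullRank {σ K : Type*} [Field K] (J : Ideal (MvPolynomial σ K))
    (l : MvPolynomial σ K) (i : ℕ) : Prop :=
  Set.InjOn (fun a => Ideal.Quotient.mk J l * a) (gradedPiece J i) ∨
    Set.SurjOn (fun a => Ideal.Quotient.mk J l * a) (gradedPiece J i) (gradedPiece J (i + 1))

/-- The Weak Lefschetz Property of the standard graded algebra `K[x]/J`: some linear form
multiplies with full rank in every degree. Having full rank is a Zariski open condition on the
linear form, so over an infinite field this says the same as "a general linear form does". -/
def HasWLP {σ K : Type*} [Field K] (J : Ideal (MvPolynomial σ K)) : Prop :=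
  ∃ l : MvPolynomial σ K, l.IsHomogeneous 1 ∧ ∀ i, MulHasFullRank J l i

/-- `x` is a homogeneous element of degree `a` of the graded free module `⨁ j, S(-deg j)`: every
monomial `s` occurring in the coordinate `x j` satisfies `|s| + deg j = a`. -/
def IsHomogeneousVec {σ K ι : Type*} [Field K] (deg : ι → ℕ) (x : ι → MvPolynomial σ K)
    (a : ℕ) : Prop :=
  ∀ j, ∀ s : σ →₀ ℕ, coeff s (x j) ≠ 0 → s.degree + deg j = a

/-- A minimal graded free resolution `⋯ ⟶ F₂ ⟶ F₁ ⟶ F₀ ⟶ S/I ⟶ 0` over the polynomial ring `S`,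
where `F i = ⨁ k, S(-deg i k)` has finite rank. -/
structure MinimalGradedFreeResolution {σ K : Type*} [Field K] (I : Ideal (MvPolynomial σ K)) where
  /-- the rank of `F i` -/
  rank : ℕ → ℕ
  /-- the degrees of the basis elements of `F i` -/
  deg : (i : ℕ) → Fin (rank i) → ℕ
  /-- the differential `F (i + 1) ⟶ F i` -/
  d : (i : ℕ) → (Fin (rank (i + 1)) → MvPolynomial σ K) →ₗ[MvPolynomial σ K]
    (Fin (rank i) → MvPolynomial σ K)
  /-- the augmentation `F 0 ⟶ S/I` -/
  aug : (Fin (rank 0) → MvPolynomial σ K) →ₗ[MvPolynomial σ K] (MvPolynomial σ K ⧸ I)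
  d_homogeneous : ∀ i k, IsHomogeneousVec (deg i) (d i (Pi.single k 1)) (deg (i + 1) k)
  aug_homogeneous : ∀ k, aug (Pi.single k 1) ∈ gradedPiece I (deg 0 k)
  aug_surjective : Function.Surjective aug
  exact_zero : Function.Exact (d 0) aug
  exact_succ : ∀ i, Function.Exact (d (i + 1)) (d i)
  /-- minimality: the entries of the differentials lie in the irrelevant maximal ideal -/
  minimal : ∀ i k j, constantCoeff (d i (Pi.single k 1) j) = 0

/-- The Betti table of a minimal graded free resolution. The entry in column `i` and row `j` is the
graded Betti number `β_{i,i+j}`, the number of summands `S(-(i + j))` of `F i`. -/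
def MinimalGradedFreeResolution.bettiTable {σ K : Type*} [Field K] {I : Ideal (MvPolynomial σ K)}
    (F : MinimalGradedFreeResolution I) (i j : ℕ) : ℕ :=
  (Finset.univ.filter fun k : Fin (F.rank i) => F.deg i k = i + j).card

/-- The table `B` (column `i`, row `j`) has a `(c, d)`-Koszul tail: in the block of the columns
`0, …, c` and the rows `0, …, d`, row `0` is `1, 0, …, 0`, the rows `1, …, d - 1` vanish, and row
`d` is `0, c, c.choose 2, …, c, 1`. -/
def HasKoszulTail (B : ℕ → ℕ → ℕ) (c d : ℕ) : Prop :=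
  (B 0 0 = 1 ∧ ∀ i, 1 ≤ i → i ≤ c → B i 0 = 0) ∧
  (∀ i j, i ≤ c → 1 ≤ j → j < d → B i j = 0) ∧
  (B 0 d = 0 ∧ ∀ i, 1 ≤ i → i ≤ c → B i d = c.choose i)

/-!
Write `c = n - m`, let `Q` be the ideal generated by the regular sequence `l` of linear forms, so
that `A = S/(I + Q)`, and let `F` be the minimal free resolution of `S/I`. The Artinian property is a
count of Krull dimensions. The weak Lefschetz property fails in degree `d`, for any linear form `u`.

*A socle element.* Complete `l` to a basis `a₀, a₁, …` of the linear forms. Since `l` is regular both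
on `S` and on `S/I`, reducing `F` modulo `l` creates no homology in positive degrees, and each further
linear form raises the top homological degree by at most one
(`MinimalGradedFreeResolution.exists_sub_d_mem`). A basis element of `F c` of degree `c + d`, which
exists as `β_{c,c+d} = 1`, is a nonzero class modulo all variables. Removing the additional `c` linear
forms one at a time, the connecting homomorphisms carry it injectively to a class in homological
degree `0`, that is, to a nonzero element of degree `d` of `A`, represented by a form `f`; all
variables kill the class at each step (`MinimalGradedFreeResolution.exists_isSocleClass_pred`,
`MinimalGradedFreeResolution.exists_socle_form`). This is the isomorphism of `Tor_c(S/I, K)` with the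
socle of `A`, made explicit. Hence `u` kills a nonzero element of `A_d` and is not injective on it.

*Few forms of degree `d + 1`.* As `I` has no generators of degree at most `d`, and `c` of degree
`d + 1`, its forms of degree `d + 1` span at most `c` dimensions
(`MinimalGradedFreeResolution.exists_submodule_of_hasKoszulTail`). Modulo `Q`, which is a prime ideal
with polynomial quotient, the products of `f` with linear forms already span `c` dimensions inside
the image of `I`, so they are all of it (`exists_sub_mul_linForm_mem`). If `u : A_d → A_{d+1}` were
surjective, then in the polynomial ring `S/(Q, u)`, which has at least `c - 1 ≥ 2` variables, every
form of degree `d + 1` would be a multiple of `f`. This is absurd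
(`exists_form_notMem_of_two_le_codim`).
-/

/-! ### Linear forms and the ideals they generate -/

/-- The linear form `∑ j, v j * X j` with coefficient vector `v`. -/
noncomputable def linForm (K : Type*) {σ : Type*} [Field K] [Fintype σ] :
    (σ → K) →ₗ[K] MvPolynomial σ K :=
  Fintype.linearCombination K X

section LinForm

variable {K σ : Type*} [Field K] [Fintype σ]

theorem linForm_apply (v : σ → K) : linForm K v = ∑ j, v j • (X j : MvPolynomial σ K) :=
  Fintype.linearCombination_apply ..

theorem isHomogeneous_linForm (v : σ → K) : (linForm K v).IsHomogeneous 1 := by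
  rw [linForm_apply]
  refine IsHomogeneous.sum _ _ _ fun j _ => ?_
  rw [smul_eq_C_mul]
  simpa using (isHomogeneous_C σ (v j)).mul (isHomogeneous_X K j)

theorem exists_linForm_eq {p : MvPolynomial σ K} (hp : p.IsHomogeneous 1) :
    ∃ v, linForm K v = p := by
  have h : p ∈ homogeneousSubmodule σ K 1 := hp
  rw [homogeneousSubmodule_one_eq_span_X] at h
  obtain ⟨v, hv⟩ := (Submodule.mem_span_range_iff_exists_fun K).1 h
  exact ⟨v, by rw [linForm_apply, hv]⟩

theorem linForm_single [DecidableEq σ] (j : σ) :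
    linForm K (Pi.single j 1) = (X j : MvPolynomial σ K) := by
  simp [linForm]

theorem linForm_injective : Function.Injective (linForm K (σ := σ)) := by
  classical
  rw [injective_iff_map_eq_zero]
  intro v hv
  ext j
  have h := congrArg (coeff (Finsupp.single j 1)) hv
  simpa [linForm_apply, coeff_sum, coeff_smul, coeff_X, Finsupp.single_left_inj] using h

theorem aeval_linForm {A : Type*} [CommRing A] [Algebra K A] (u : σ → A) (v : σ → K) :
    aeval u (linForm K v) = ∑ j, v j • u j := by
  simp [linForm_apply, map_sum]

/-- A linear projection of the coefficient space with kernel `V` extends to an algebra endomorphism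
of the polynomial ring that is congruent to the identity modulo its kernel: it retracts the ring onto
a polynomial subring, with kernel the ideal generated by
the linear forms in `V`. -/
theorem exists_retraction (V : Submodule K (σ → K)) :
    ∃ (p : (σ → K) →ₗ[K] (σ → K)) (ψ : MvPolynomial σ K →ₐ[K] MvPolynomial σ K),
      LinearMap.ker p = V ∧ (∀ v, ψ (linForm K v) = linForm K (p v)) ∧
      (∀ g, g - ψ g ∈ Ideal.span (linForm K '' (V : Set (σ → K)))) ∧
      RingHom.ker ψ = Ideal.span (linForm K '' (V : Set (σ → K))) := by
  classical
  obtain ⟨W, hW⟩ := V.exists_isCompl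
  set p : (σ → K) →ₗ[K] (σ → K) := W.subtype ∘ₗ W.projectionOnto V hW.symm with hp
  have hker : LinearMap.ker p = V := by
    rw [hp, LinearMap.ker_comp_of_ker_eq_bot _ (Submodule.ker_subtype W)]
    simp
  have hpp : ∀ v, v - p v ∈ V := by
    intro v
    rw [← hker, LinearMap.mem_ker, map_sub, sub_eq_zero]
    simp only [hp, LinearMap.comp_apply, Submodule.subtype_apply]
    rw [Submodule.projectionOnto_apply_left]
  set ψ : MvPolynomial σ K →ₐ[K] MvPolynomial σ K :=
    aeval fun j => linForm K (p (Pi.single j 1)) with hψ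
  have hlin : ∀ v, ψ (linForm K v) = linForm K (p v) := by
    intro v
    rw [hψ, aeval_linForm]
    conv_rhs => rw [show v = ∑ j, v j • Pi.single j (1 : K) by
      ext j; simp [Finset.sum_apply, Pi.single_apply]]
    simp only [map_sum, map_smul]
  have hsub : ∀ g, g - ψ g ∈ Ideal.span (linForm K '' (V : Set (σ → K))) := by
    intro g
    rw [← Ideal.Quotient.mk_eq_mk_iff_sub_mem]
    induction g using MvPolynomial.induction_on with
    | C r => simp [algebraMap_eq]
    | add f g hf hg => rw [map_add, map_add, map_add, hf, hg]
    | mul_X f j hf =>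
      rw [map_mul, map_mul, map_mul, hf]
      congr 1
      rw [hψ, aeval_X, Ideal.Quotient.mk_eq_mk_iff_sub_mem, ← linForm_single, ← map_sub]
      exact Ideal.subset_span ⟨_, hpp _, rfl⟩
  refine ⟨p, ψ, hker, hlin, hsub, le_antisymm (fun g hg => ?_) (Ideal.span_le.2 ?_)⟩
  · have h1 := hsub g
    rwa [RingHom.mem_ker.1 hg, sub_zero] at h1
  · rintro _ ⟨v, hv, rfl⟩
    have h1 : p v = 0 := by rwa [← LinearMap.mem_ker, hker]
    simp [RingHom.mem_ker, hlin, h1]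

/-- The ideal generated by a linear space of linear forms is prime, being the kernel of a
retraction of the polynomial ring; it contains no further linear forms. -/
theorem isPrime_span_linForm (V : Submodule K (σ → K)) :
    (Ideal.span (linForm K '' (V : Set (σ → K)))).IsPrime ∧
      ∀ v, linForm K v ∈ Ideal.span (linForm K '' (V : Set (σ → K))) → v ∈ V := by
  obtain ⟨p, ψ, hker, hlin, -, heq⟩ := exists_retraction V
  refine ⟨heq ▸ RingHom.ker_isPrime ψ, fun v hv => ?_⟩
  have h0 : ψ (linForm K v) = 0 := RingHom.mem_ker.1 (heq ▸ hv)
  rw [hlin] at h0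
  rw [← hker, LinearMap.mem_ker]
  exact linForm_injective (by rw [h0, map_zero])

theorem span_linForm_image (s : Set (σ → K)) :
    Ideal.span (linForm K '' (Submodule.span K s : Set (σ → K))) =
      Ideal.span (linForm K '' s) := by
  refine le_antisymm (Ideal.span_le.2 ?_)
    (Ideal.span_mono (Set.image_mono Submodule.subset_span))
  rintro _ ⟨v, hv, rfl⟩
  induction hv using Submodule.span_induction with
  | mem x hx => exact Ideal.subset_span ⟨x, hx, rfl⟩
  | zero => simp
  | add x y _ _ hx hy => rw [map_add]; exact Ideal.add_mem _ hx hy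
  | smul r x _ hx =>
    rw [map_smul, smul_eq_C_mul]
    exact Ideal.mul_mem_left _ _ hx

end LinForm

/-! ### Regular sequences of linear forms -/

theorem mem_span_image_Iio_succ {R : Type*} [CommRing R] (a : ℕ → R) (k : ℕ) {z : R} :
    z ∈ Ideal.span (a '' Set.Iio (k + 1)) ↔
      ∃ w, z - a k * w ∈ Ideal.span (a '' Set.Iio k) := by
  have : a '' Set.Iio (k + 1) = insert (a k) (a '' Set.Iio k) := by
    rw [← Set.image_insert_eq]
    congr 1
    ext j
    simp only [Set.mem_Iio, Set.mem_insert_iff]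
    omega
  rw [this, Ideal.mem_span_insert]
  constructor
  · rintro ⟨w, q, hq, rfl⟩
    exact ⟨w, by simpa [mul_comm] using hq⟩
  · rintro ⟨w, hw⟩
    exact ⟨w, _, hw, by ring⟩

theorem ofList_take_ofFn {R : Type*} [CommRing R] (a : ℕ → R) {r k : ℕ} (hk : k ≤ r) :
    Ideal.ofList ((List.ofFn fun i : Fin r => a i).take k) = Ideal.span (a '' Set.Iio k) := by
  unfold Ideal.ofList
  congr 1
  ext x
  simp only [List.mem_take_iff_getElem, Set.mem_image, Set.mem_Iio, Set.mem_ofPred_eq,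
    List.getElem_ofFn, List.length_ofFn, lt_min_iff]
  constructor
  · rintro ⟨j, hj, rfl⟩
    exact ⟨j, hj.1, rfl⟩
  · rintro ⟨j, hj, rfl⟩
    exact ⟨j, ⟨hj, by omega⟩, rfl⟩

theorem mk_mem_smul_top_iff {R : Type*} [CommRing R] (I Q : Ideal R) (g : R) :
    Ideal.Quotient.mk I g ∈ (Q • ⊤ : Submodule R (R ⧸ I)) ↔ g ∈ I ⊔ Q := by
  rw [Ideal.smul_top_eq_map, Submodule.restrictScalars_mem, Ideal.Quotient.algebraMap_eq,
    Ideal.mem_quotient_iff_mem_sup, sup_comm]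

/-- Weak regularity on `R/I` of a sequence, read off in `R`. -/
theorem mem_of_mul_mem_of_isWeaklyRegular {R : Type*} [CommRing R] {I : Ideal R} {a : ℕ → R} {r : ℕ}
    (h : RingTheory.Sequence.IsWeaklyRegular (R ⧸ I) (List.ofFn fun i : Fin r => a i))
    {k : ℕ} (hk : k < r) {g : R} (hg : a k * g ∈ I ⊔ Ideal.span (a '' Set.Iio k)) :
    g ∈ I ⊔ Ideal.span (a '' Set.Iio k) := by
  have h1 := h.regular_mod_prev k (by simpa using hk)
  rw [ofList_take_ofFn a hk.le] at h1
  simp only [List.getElem_ofFn] at h1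
  rw [← mk_mem_smul_top_iff] at hg ⊢
  rw [← Submodule.Quotient.mk_eq_zero] at hg ⊢
  refine h1 ?_
  simp only [smul_zero]
  rw [← Submodule.Quotient.mk_smul, ← hg]
  congr 1

theorem one_notMem_of_isRegular {R : Type*} [CommRing R] {I : Ideal R} {a : ℕ → R} {r : ℕ}
    (h : RingTheory.Sequence.IsRegular (R ⧸ I) (List.ofFn fun i : Fin r => a i)) :
    (1 : R) ∉ I ⊔ Ideal.span (a '' Set.Iio r) := by
  intro h1
  rw [← mk_mem_smul_top_iff] at h1
  refine h.top_ne_smul (Eq.symm ?_)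
  have h2 := ofList_take_ofFn a (le_refl r)
  rw [List.take_of_length_le (by simp)] at h2
  rw [h2, eq_top_iff]
  rintro x -
  obtain ⟨x, rfl⟩ := Ideal.Quotient.mk_surjective x
  have := Submodule.smul_mem _ x h1
  rwa [Algebra.smul_def, Ideal.Quotient.algebraMap_eq, ← map_mul, mul_one] at this

theorem exists_linearIndependent_extension {K E : Type*} [Field K] [AddCommGroup E] [Module K E]
    [FiniteDimensional K E] {r N : ℕ} (hr : r ≤ N) (hN : N ≤ Module.finrank K E) (w : ℕ → E)
    (hw : LinearIndependent K fun i : Fin r => w i) :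
    ∃ w' : ℕ → E, (∀ i < r, w' i = w i) ∧ LinearIndependent K fun i : Fin N => w' i := by
  induction N, hr using Nat.le_induction with
  | base => exact ⟨w, fun _ _ => rfl, hw⟩
  | succ N hr ih =>
    obtain ⟨w', h1, h2⟩ := ih (by omega)
    obtain ⟨y, hy⟩ := exists_linearIndependent_snoc_of_lt_finrank h2 (by omega)
    refine ⟨Function.update w' N y, fun i hi => ?_, ?_⟩
    · rw [Function.update_of_ne (by omega), h1 i hi]
    · have heq : (fun i : Fin (N + 1) => Function.update w' N y i) =
          Fin.snoc (fun i : Fin N => w' i) y := by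
        ext i : 1
        refine Fin.lastCases ?_ (fun j => ?_) i
        · simp
        · simp [j.2.ne]
      rw [heq]
      exact hy

section Sequence

variable {K : Type*} [Field K]

/-- Linear forms that form a regular sequence on `S/I` are linearly independent. -/
theorem linearIndependent_of_isRegular {σ : Type*} [Fintype σ] {I : Ideal (MvPolynomial σ K)}
    {r : ℕ} (w : ℕ → σ → K)
    (h : RingTheory.Sequence.IsRegular (MvPolynomial σ K ⧸ I)
      (List.ofFn fun i : Fin r => linForm K (w i))) {k : ℕ} (hk : k ≤ r) :
    LinearIndependent K fun i : Fin k => w i := by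
  induction k with
  | zero => exact linearIndependent_empty_type
  | succ k ih =>
    rw [linearIndependent_finSucc']
    refine ⟨ih (by omega), fun hmem => ?_⟩
    have himg : Set.range (Fin.init fun i : Fin (k + 1) => w i) ⊆ w '' Set.Iio k := by
      rintro _ ⟨i, rfl⟩
      exact ⟨i, i.2, rfl⟩
    have h1 : linForm K (w k) ∈ Ideal.span ((fun i => linForm K (w i)) '' Set.Iio k) := by
      rw [← Set.image_image (linForm K) w, ← span_linForm_image]
      exact Ideal.subset_span ⟨_, Submodule.span_mono himg hmem, rfl⟩
    have h2 := mem_of_mul_mem_of_isWeaklyRegular (a := fun i => linForm K (w i)) h.toIsWeaklyRegular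
      (k := k) (by omega) (g := 1) (by rw [mul_one]; exact Ideal.mem_sup_right h1)
    refine one_notMem_of_isRegular (a := fun i => linForm K (w i)) h ?_
    refine sup_le_sup_left ?_ I h2
    exact Ideal.span_mono (Set.image_mono (Set.Iio_subset_Iio (by omega)))

theorem mem_of_mul_mem_of_linearIndependent {σ : Type*} [Fintype σ] {N : ℕ} {w : ℕ → σ → K}
    (hw : LinearIndependent K fun i : Fin N => w i) {k : ℕ} (hk : k < N) {g : MvPolynomial σ K}
    (hg : linForm K (w k) * g ∈ Ideal.span ((fun i => linForm K (w i)) '' Set.Iio k)) :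
    g ∈ Ideal.span ((fun i => linForm K (w i)) '' Set.Iio k) := by
  rw [← Set.image_image (linForm K) w, ← span_linForm_image] at hg ⊢
  obtain ⟨hprime, hlin⟩ := isPrime_span_linForm (Submodule.span K (w '' Set.Iio k))
  refine (hprime.mem_or_mem hg).resolve_left fun h => ?_
  have h2 := hw.notMem_span_image (s := {i : Fin N | (i : ℕ) < k}) (x := ⟨k, hk⟩) (by simp)
  refine h2 (Submodule.span_mono ?_ (hlin _ h))
  rintro _ ⟨i, hi, rfl⟩
  exact ⟨⟨i, lt_trans hi hk⟩, hi, rfl⟩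

theorem X_mem_span_of_linearIndependent {σ : Type*} [Fintype σ] {w : ℕ → σ → K}
    (hw : LinearIndependent K fun i : Fin (Fintype.card σ) => w i) (j : σ) :
    (X j : MvPolynomial σ K) ∈
      Ideal.span ((fun i => linForm K (w i)) '' Set.Iio (Fintype.card σ)) := by
  classical
  have htop : Submodule.span K (w '' Set.Iio (Fintype.card σ)) = ⊤ := by
    rw [eq_top_iff, ← hw.span_eq_top_of_card_eq_finrank' (by simp)]
    refine Submodule.span_mono ?_
    rintro _ ⟨i, rfl⟩
    exact ⟨i, i.2, rfl⟩
  rw [← Set.image_image (linForm K) w, ← span_linForm_image, htop]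
  exact Ideal.subset_span ⟨Pi.single j 1, trivial, linForm_single j⟩

end Sequence

/-! ### Linear maps between finite free modules -/

theorem map_eq_sum_smul_single {R ι M : Type*} [CommRing R] [Fintype ι] [DecidableEq ι]
    [AddCommGroup M] [Module R M] (D : (ι → R) →ₗ[R] M) (z : ι → R) :
    D z = ∑ i, z i • D (Pi.single i 1) := by
  conv_lhs => rw [pi_eq_sum_univ' z]
  rw [map_sum]
  refine Finset.sum_congr rfl fun i _ => ?_
  rw [map_smul]

theorem map_apply_mem {R ι κ : Type*} [CommRing R] [Finite ι] {Q : Ideal R}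
    (D : (ι → R) →ₗ[R] (κ → R)) {z : ι → R} (hz : ∀ i, z i ∈ Q) (j : κ) : D z j ∈ Q := by
  classical
  have := Fintype.ofFinite ι
  rw [map_eq_sum_smul_single D z, Finset.sum_apply]
  exact Ideal.sum_mem _ fun i _ => Ideal.mul_mem_right _ _ (hz i)

/-! ### Homogeneous components -/

theorem weight_one_eq_degree {σ : Type*} (s : σ →₀ ℕ) : Finsupp.weight (1 : σ → ℕ) s = s.degree := by
  rw [Finsupp.degree_eq_weight_one]
  rfl

section Components

variable {K σ : Type*} [Field K]

theorem homogeneousComponent_mul_left {p : MvPolynomial σ K} {i : ℕ} (hp : p.IsHomogeneous i)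
    (z : MvPolynomial σ K) (n : ℕ) :
    homogeneousComponent n (p * z) = if i ≤ n then p * homogeneousComponent (n - i) z else 0 := by
  have h : ∀ k (f : MvPolynomial σ K), homogeneousComponent k f =
      (DirectSum.decompose (homogeneousSubmodule σ K) f k : MvPolynomial σ K) :=
    fun k f => (decomposition.decompose'_apply f k).symm
  rw [h, h, DirectSum.coe_decompose_mul_of_left_mem _ n hp]

theorem isHomogeneous_span_of_linear {s : Set (MvPolynomial σ K)}
    (hs : ∀ x ∈ s, x.IsHomogeneous 1) :
    (Ideal.span s).IsHomogeneous (homogeneousSubmodule σ K) :=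
  Ideal.homogeneous_span _ _ fun x hx => ⟨1, hs x hx⟩

variable {ι κ : Type*}

/-- The component of degree `a` of a vector in the graded free module `⨁ j, S(-deg j)`. -/
noncomputable def vecComponent (deg : ι → ℕ) (a : ℕ) (z : ι → MvPolynomial σ K) :
    ι → MvPolynomial σ K :=
  fun j => if deg j ≤ a then homogeneousComponent (a - deg j) (z j) else 0

theorem isHomogeneousVec_vecComponent (deg : ι → ℕ) (a : ℕ) (z : ι → MvPolynomial σ K) :
    IsHomogeneousVec deg (vecComponent deg a z) a := by
  intro j s hs
  unfold vecComponent at hs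
  split_ifs at hs with h
  · rw [coeff_homogeneousComponent] at hs
    split_ifs at hs with h2
    · omega
    · exact absurd rfl hs
  · exact absurd (coeff_zero s) hs

theorem vecComponent_eq_self {deg : ι → ℕ} {a : ℕ} {z : ι → MvPolynomial σ K}
    (hz : IsHomogeneousVec deg z a) : vecComponent deg a z = z := by
  ext j s
  unfold vecComponent
  by_cases hc : coeff s (z j) = 0
  · split_ifs
    · rw [coeff_homogeneousComponent, hc, ite_self]
    · rw [coeff_zero, hc]
  · have := hz j s hc
    rw [if_pos (by omega), coeff_homogeneousComponent, if_pos (by omega)]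

theorem vecComponent_add (deg : ι → ℕ) (a : ℕ) (z w : ι → MvPolynomial σ K) :
    vecComponent deg a (z + w) = vecComponent deg a z + vecComponent deg a w := by
  ext1 j
  simp only [vecComponent, Pi.add_apply, map_add]
  split_ifs <;> simp

theorem vecComponent_linear_smul (deg : ι → ℕ) (a : ℕ) {p : MvPolynomial σ K}
    (hp : p.IsHomogeneous 1) (z : ι → MvPolynomial σ K) :
    vecComponent deg (a + 1) (p • z) = p • vecComponent deg a z := by
  ext1 j
  simp only [vecComponent, Pi.smul_apply, smul_eq_mul, homogeneousComponent_mul_left hp]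
  by_cases h : deg j ≤ a
  · rw [if_pos (by omega), if_pos (by omega), if_pos h]
    congr 3
    omega
  · rw [if_neg h, mul_zero]
    split_ifs <;> first | rfl | omega

theorem vecComponent_mem {Q : Ideal (MvPolynomial σ K)}
    (hQ : Q.IsHomogeneous (homogeneousSubmodule σ K)) (deg : ι → ℕ) (a : ℕ)
    {z : ι → MvPolynomial σ K} (hz : ∀ j, z j ∈ Q) (j : ι) : vecComponent deg a z j ∈ Q := by
  unfold vecComponent
  split_ifs
  · exact homogeneousComponent_mem_of_mem hQ (hz j) _
  · exact Q.zero_mem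

variable [Fintype ι] [DecidableEq ι]

theorem IsHomogeneousVec.map {deg : ι → ℕ} {deg' : κ → ℕ}
    {D : (ι → MvPolynomial σ K) →ₗ[MvPolynomial σ K] (κ → MvPolynomial σ K)}
    (hD : ∀ k, IsHomogeneousVec deg' (D (Pi.single k 1)) (deg k)) {e : ι → MvPolynomial σ K} {a : ℕ}
    (he : IsHomogeneousVec deg e a) : IsHomogeneousVec deg' (D e) a := by
  classical
  intro j s hs
  rw [map_eq_sum_smul_single D e, Finset.sum_apply, coeff_sum] at hs
  obtain ⟨i, -, hi⟩ := Finset.exists_ne_zero_of_sum_ne_zero hs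
  rw [Pi.smul_apply, smul_eq_mul, coeff_mul] at hi
  obtain ⟨⟨s1, s2⟩, hmem, hne⟩ := Finset.exists_ne_zero_of_sum_ne_zero hi
  replace hmem : s1 + s2 = s := Finset.HasAntidiagonal.mem_antidiagonal.1 hmem
  have h1 := he i s1 (left_ne_zero_of_mul hne)
  have h2 := hD i j s2 (right_ne_zero_of_mul hne)
  rw [← hmem, map_add]
  omega

end Components

/-! ### A free resolution modulo a sequence of linear forms -/

section Resolution

variable {K σ : Type*} [Field K] {I : Ideal (MvPolynomial σ K)}

theorem MinimalGradedFreeResolution.d_d (F : MinimalGradedFreeResolution I) (i : ℕ)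
    (z : Fin (F.rank (i + 2)) → MvPolynomial σ K) : F.d i (F.d (i + 1) z) = 0 :=
  (F.exact_succ i).apply_apply_eq_zero z

theorem exists_smul_sub_mem {ι : Type*} {a : ℕ → MvPolynomial σ K} {k : ℕ}
    {z : ι → MvPolynomial σ K} (hz : ∀ j, z j ∈ Ideal.span (a '' Set.Iio (k + 1))) :
    ∃ w : ι → MvPolynomial σ K, ∀ j, (z - a k • w) j ∈ Ideal.span (a '' Set.Iio k) := by
  choose w hw using fun j => (mem_span_image_Iio_succ a k).1 (hz j)
  exact ⟨w, hw⟩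

theorem smul_quotient_mk (a s : MvPolynomial σ K) :
    a • Ideal.Quotient.mk I s = Ideal.Quotient.mk I (a * s) := rfl

theorem MinimalGradedFreeResolution.mem_of_mk_eq_aug (F : MinimalGradedFreeResolution I)
    {Q : Ideal (MvPolynomial σ K)} {v : Fin (F.rank 0) → MvPolynomial σ K} (hv : ∀ j, v j ∈ Q)
    {s : MvPolynomial σ K} (hs : Ideal.Quotient.mk I s = F.aug v) : s ∈ I ⊔ Q := by
  rw [← mk_mem_smul_top_iff, hs, map_eq_sum_smul_single F.aug v]
  exact Submodule.sum_mem _ fun i _ => Submodule.smul_mem_smul (hv i) trivial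

theorem MinimalGradedFreeResolution.exists_sub_mem_of_mem (F : MinimalGradedFreeResolution I)
    {Q : Ideal (MvPolynomial σ K)} {w : Fin (F.rank 0) → MvPolynomial σ K}
    {s : MvPolynomial σ K} (hs : Ideal.Quotient.mk I s = F.aug w) (h : s ∈ I ⊔ Q) :
    ∃ g, ∀ j, (w - F.d 0 g) j ∈ Q := by
  obtain ⟨x, hx, q, hq, hxq⟩ := Submodule.mem_sup.1 h
  obtain ⟨u, hu⟩ := F.aug_surjective (Ideal.Quotient.mk I 1)
  have hker : F.aug (w - q • u) = 0 := by
    rw [map_sub, map_smul, hu, ← hs, ← hxq, smul_quotient_mk, mul_one, map_add,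
      Ideal.Quotient.eq_zero_iff_mem.2 hx, zero_add, sub_self]
  obtain ⟨g, hg⟩ := (F.exact_zero _).1 hker
  refine ⟨g, fun j => ?_⟩
  rw [hg, sub_sub_cancel]
  exact Ideal.mul_mem_right _ _ hq

/-- If `a` is regular on `S/(I + Q)`, then `a • w ∈ im d₀ + Q F₀` forces `w ∈ im d₀ + Q F₀`. -/
theorem MinimalGradedFreeResolution.exists_sub_mem_of_smul_sub_mem
    (F : MinimalGradedFreeResolution I) {Q : Ideal (MvPolynomial σ K)} {a : MvPolynomial σ K}
    (ha : ∀ g, a * g ∈ I ⊔ Q → g ∈ I ⊔ Q) {w : Fin (F.rank 0) → MvPolynomial σ K}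
    {z : Fin (F.rank 1) → MvPolynomial σ K} (h : ∀ j, (F.d 0 z - a • w) j ∈ Q) :
    ∃ g, ∀ j, (w - F.d 0 g) j ∈ Q := by
  obtain ⟨s, hs⟩ := Ideal.Quotient.mk_surjective (F.aug w)
  refine F.exists_sub_mem_of_mem hs (ha s (neg_mem_iff.1 ?_))
  refine F.mem_of_mk_eq_aug h ?_
  rw [map_sub, F.exact_zero.apply_apply_eq_zero, map_smul, ← hs, smul_quotient_mk, map_neg,
    zero_sub]

/-- Let `a` be a sequence of which each of the first `N` terms is regular modulo its predecessors,
and whose first `r` terms are a regular sequence on `S/I`. Then killing `k` terms creates homology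
in the resolution of `S/I` at most in the homological degrees up to `k - r`. -/
theorem MinimalGradedFreeResolution.exists_sub_d_mem (F : MinimalGradedFreeResolution I)
    {a : ℕ → MvPolynomial σ K} {N r : ℕ}
    (ha : ∀ k < N, ∀ g, a k * g ∈ Ideal.span (a '' Set.Iio k) → g ∈ Ideal.span (a '' Set.Iio k))
    (hI : ∀ k < r, ∀ g, a k * g ∈ I ⊔ Ideal.span (a '' Set.Iio k) →
      g ∈ I ⊔ Ideal.span (a '' Set.Iio k))
    (k : ℕ) (hk : k ≤ N) (i : ℕ) (hki : k ≤ r + i) (z : Fin (F.rank (i + 1)) → MvPolynomial σ K)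
    (hz : ∀ j, F.d i z j ∈ Ideal.span (a '' Set.Iio k)) :
    ∃ g, ∀ j, (z - F.d (i + 1) g) j ∈ Ideal.span (a '' Set.Iio k) := by
  induction k generalizing i z with
  | zero =>
    have h0 : Ideal.span (a '' Set.Iio 0) = ⊥ := by simp
    rw [h0] at hz ⊢
    obtain ⟨g, hg⟩ := (F.exact_succ i z).1 (funext fun j => hz j)
    exact ⟨g, fun j => by rw [hg, sub_self]; exact Ideal.zero_mem _⟩
  | succ k ih =>
    obtain ⟨w, hw⟩ := exists_smul_sub_mem hz
    -- `w` is a cycle modulo the first `k` terms, hence a boundary there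
    have hwb : ∃ u, ∀ j, (w - F.d i u) j ∈ Ideal.span (a '' Set.Iio k) := by
      cases i with
      | zero => exact F.exists_sub_mem_of_smul_sub_mem (hI k (by omega)) hw
      | succ i =>
        refine ih (by omega) i (by omega) w fun j => ha k (by omega) _ ?_
        have h1 := map_apply_mem (F.d i) hw j
        rw [map_sub, F.d_d, zero_sub, map_smul] at h1
        simpa using h1
    obtain ⟨u, hu⟩ := hwb
    obtain ⟨g, hg⟩ := ih (by omega) i (by omega) (z - a k • u) fun j => by
      have h1 := Ideal.add_mem _ (hw j) (Ideal.mul_mem_left _ (a k) (hu j))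
      convert h1 using 1
      simp only [map_sub, map_smul, Pi.sub_apply, Pi.smul_apply, smul_eq_mul]
      ring
    refine ⟨g, fun j => (mem_span_image_Iio_succ a k).2 ⟨u j, ?_⟩⟩
    convert hg j using 1
    simp only [Pi.sub_apply, Pi.smul_apply, smul_eq_mul]
    ring

/-- `e` represents a nonzero class, killed by all variables, in the homology of the resolution `F`
modulo the ideal `Q` at the spot `F i`, except that `e` is not required to be a cycle. -/
structure MinimalGradedFreeResolution.IsSocleClass (F : MinimalGradedFreeResolution I)
    (Q : Ideal (MvPolynomial σ K)) (i : ℕ) (e : Fin (F.rank i) → MvPolynomial σ K) : Prop where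
  not_boundary : ¬ ∃ g, ∀ j, (e - F.d i g) j ∈ Q
  X_smul : ∀ x : σ, ∃ g, ∀ j, ((X x : MvPolynomial σ K) • e - F.d i g) j ∈ Q

/-- One step down the staircase: a socle class in homological degree `i + 1` modulo `N + 1` linear
forms comes, by the connecting homomorphism, from one in degree `i` modulo the first `N` of them. -/
theorem MinimalGradedFreeResolution.exists_isSocleClass_pred (F : MinimalGradedFreeResolution I)
    {a : ℕ → MvPolynomial σ K} {N i b : ℕ} (hlin : ∀ k ≤ N, (a k).IsHomogeneous 1)
    (ha : ∀ g, a N * g ∈ Ideal.span (a '' Set.Iio N) → g ∈ Ideal.span (a '' Set.Iio N))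
    (hex : ∀ z, (∀ j, F.d i z j ∈ Ideal.span (a '' Set.Iio N)) →
      ∃ g, ∀ j, (z - F.d (i + 1) g) j ∈ Ideal.span (a '' Set.Iio N))
    {e : Fin (F.rank (i + 1)) → MvPolynomial σ K}
    (he : F.IsSocleClass (Ideal.span (a '' Set.Iio (N + 1))) (i + 1) e)
    (hcycle : ∀ j, F.d i e j ∈ Ideal.span (a '' Set.Iio (N + 1)))
    (hdeg : IsHomogeneousVec (F.deg (i + 1)) e (b + 1)) :
    ∃ w, F.IsSocleClass (Ideal.span (a '' Set.Iio N)) i w ∧ IsHomogeneousVec (F.deg i) w b ∧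
      ∀ j, (F.d i e - a N • w) j ∈ Ideal.span (a '' Set.Iio N) := by
  obtain ⟨w', hw'⟩ := exists_smul_sub_mem hcycle
  have hQ : (Ideal.span (a '' Set.Iio N)).IsHomogeneous (homogeneousSubmodule σ K) := by
    refine isHomogeneous_span_of_linear ?_
    rintro _ ⟨j, hj, rfl⟩
    exact hlin j (le_of_lt hj)
  set w := vecComponent (F.deg i) b w' with hwdef
  have hw : ∀ j, (F.d i e - a N • w) j ∈ Ideal.span (a '' Set.Iio N) := by
    have h1 := vecComponent_mem hQ (F.deg i) (b + 1) hw'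
    have h2 : vecComponent (F.deg i) (b + 1) (F.d i e - a N • w') = F.d i e - a N • w := by
      rw [eq_sub_iff_add_eq, hwdef, ← vecComponent_linear_smul _ _ (hlin N le_rfl),
        ← vecComponent_add, sub_add_cancel, vecComponent_eq_self (hdeg.map (F.d_homogeneous i))]
    rwa [h2] at h1
  refine ⟨w, ⟨?_, fun x => ?_⟩, isHomogeneousVec_vecComponent _ _ _, hw⟩
  · rintro ⟨g, hg⟩
    obtain ⟨u, hu⟩ := hex (e - a N • g) fun j => by
      convert Ideal.add_mem _ (hw j) (Ideal.mul_mem_left _ (a N) (hg j)) using 1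
      simp only [map_sub, map_smul, Pi.sub_apply, Pi.smul_apply, smul_eq_mul]
      ring
    refine he.not_boundary ⟨u, fun j => (mem_span_image_Iio_succ a N).2 ⟨g j, ?_⟩⟩
    convert hu j using 1
    simp only [Pi.sub_apply, Pi.smul_apply, smul_eq_mul]
    ring
  · obtain ⟨g, hg⟩ := he.X_smul x
    obtain ⟨h, hh⟩ := exists_smul_sub_mem hg
    refine ⟨h, fun j => ha _ ?_⟩
    have h1 := map_apply_mem (F.d i) hh j
    rw [map_sub, map_sub, F.d_d, sub_zero] at h1
    convert Ideal.sub_mem _ h1 (Ideal.mul_mem_left _ (X x) (hw j)) using 1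
    simp only [map_smul, Pi.sub_apply, Pi.smul_apply, smul_eq_mul]
    ring

/-- A basis element of `F c` of degree `c + d` in the minimal free resolution of `S/I` gives
a socle element of degree `d` of the quotient of `S/I` by a regular sequence of linear forms that `c`
further linear forms complete to generators of the irrelevant ideal. -/
theorem MinimalGradedFreeResolution.exists_socle_form (F : MinimalGradedFreeResolution I)
    {a : ℕ → MvPolynomial σ K} {r c d : ℕ} (hlin : ∀ k < r + c, (a k).IsHomogeneous 1)
    (ha : ∀ k < r + c, ∀ g, a k * g ∈ Ideal.span (a '' Set.Iio k) →
      g ∈ Ideal.span (a '' Set.Iio k))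
    (hI : ∀ k < r, ∀ g, a k * g ∈ I ⊔ Ideal.span (a '' Set.Iio k) →
      g ∈ I ⊔ Ideal.span (a '' Set.Iio k))
    (hX : ∀ x, (X x : MvPolynomial σ K) ∈ Ideal.span (a '' Set.Iio (r + c)))
    (k₀ : Fin (F.rank c)) (hk₀ : F.deg c k₀ = c + d) :
    ∃ f : MvPolynomial σ K, f.IsHomogeneous d ∧ f ∉ I ⊔ Ideal.span (a '' Set.Iio r) ∧
      ∀ x, X x * f ∈ I ⊔ Ideal.span (a '' Set.Iio r) := by
  have hmax : ∀ p : MvPolynomial σ K, p ∈ Ideal.span (a '' Set.Iio (r + c)) ↔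
      constantCoeff p = 0 := by
    intro p
    refine ⟨fun h => ?_, fun h => ?_⟩
    · refine (Ideal.span_le.2 ?_ : _ ≤ RingHom.ker (constantCoeff (σ := σ) (R := K))) h
      rintro _ ⟨k, hk, rfl⟩
      exact (hlin k hk).coeff_eq_zero (by simp)
    · have h1 : p ∈ idealOfVars σ K := by
        rw [← pow_one (idealOfVars σ K), mem_pow_idealOfVars_iff']
        intro x hx
        rw [(Finsupp.degree_eq_zero_iff x).1 (by omega)]
        exact h
      refine (Ideal.span_le.2 ?_ : idealOfVars σ K ≤ _) h1
      rintro _ ⟨x, rfl⟩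
      exact hX x
  -- descending induction on the homological degree `i`; the cycle condition, which needs `i > 0`,
  -- is stated through an equation `k + 1 = i` in order to cover `i = 0` as well
  have key : ∀ i, i ≤ c → ∃ e, F.IsSocleClass (Ideal.span (a '' Set.Iio (r + i))) i e ∧
      IsHomogeneousVec (F.deg i) e (i + d) ∧
      ∀ k (h : k + 1 = i), ∀ j, F.d k (h ▸ e) j ∈ Ideal.span (a '' Set.Iio (r + i)) := by
    intro i hi
    induction hi using Nat.decreasingInduction with
    | self =>
      classical
      refine ⟨Pi.single k₀ 1, ⟨?_, fun x => ⟨0, fun j => ?_⟩⟩, ?_, ?_⟩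
      · rintro ⟨g, hg⟩
        have h1 := (hmax _).1 (hg k₀)
        rw [Pi.sub_apply, Pi.single_eq_same, map_sub, map_one] at h1
        have h2 : constantCoeff (F.d c g k₀) = 0 := by
          rw [map_eq_sum_smul_single (F.d c) g, Finset.sum_apply, map_sum]
          refine Finset.sum_eq_zero fun i _ => ?_
          rw [Pi.smul_apply, smul_eq_mul, map_mul, F.minimal c i k₀, mul_zero]
        rw [h2, sub_zero] at h1
        exact one_ne_zero h1
      · rw [map_zero, sub_zero]
        exact Ideal.mul_mem_right _ _ (hX x)
      · intro j s hs
        by_cases hj : j = k₀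
        · subst hj
          rw [Pi.single_eq_same, coeff_one] at hs
          have : s = 0 := by
            by_contra h
            exact hs (if_neg (Ne.symm h))
          rw [this, map_zero, hk₀, zero_add]
        · rw [Pi.single_eq_of_ne hj, coeff_zero] at hs
          exact absurd rfl hs
      · rintro k rfl j
        exact (hmax _).2 (F.minimal k k₀ j)
    | of_succ i hi ih =>
      obtain ⟨e, he, hdeg, hcyc⟩ := ih
      obtain ⟨w, hw, hwdeg, hwe⟩ := F.exists_isSocleClass_pred (N := r + i) (b := i + d)
        (fun k hk => hlin k (by omega)) (ha _ (by omega))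
        (fun z hz => F.exists_sub_d_mem ha hI _ (by omega) i le_rfl z hz) he (hcyc i rfl)
        (by convert hdeg using 1; omega)
      refine ⟨w, hw, hwdeg, ?_⟩
      rintro k rfl j
      have h1 := map_apply_mem (F.d k) hwe j
      rw [map_sub, F.d_d, zero_sub, map_smul] at h1
      exact ha _ (by omega) _ (by simpa using h1)
  obtain ⟨e, he, hdeg, -⟩ := key 0 (Nat.zero_le _)
  rw [zero_add] at hdeg
  have haug : F.aug e ∈ gradedPiece I d := by
    classical
    rw [map_eq_sum_smul_single F.aug e]
    refine Submodule.sum_mem _ fun i _ => ?_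
    obtain ⟨p, hp, hpe⟩ := F.aug_homogeneous i
    rw [← hpe]
    refine ⟨e i * p, ?_, rfl⟩
    intro s hs
    rw [coeff_mul] at hs
    obtain ⟨⟨s1, s2⟩, hmem, hne⟩ := Finset.exists_ne_zero_of_sum_ne_zero hs
    replace hmem : s1 + s2 = s := Finset.HasAntidiagonal.mem_antidiagonal.1 hmem
    have h1 := hdeg i s1 (left_ne_zero_of_mul hne)
    have h2 := hp (right_ne_zero_of_mul hne)
    rw [weight_one_eq_degree] at h2 ⊢
    change s1.degree + _ = _ at h1
    change s2.degree = _ at h2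
    rw [← hmem, map_add, ← h1, ← h2]
  obtain ⟨f, hf, hfe⟩ := haug
  replace hfe : Ideal.Quotient.mk I f = F.aug e := hfe
  refine ⟨f, hf, fun hmem => he.not_boundary (F.exists_sub_mem_of_mem hfe hmem), fun x => ?_⟩
  obtain ⟨g, hg⟩ := he.X_smul x
  refine F.mem_of_mk_eq_aug hg ?_
  rw [map_sub, F.exact_zero.apply_apply_eq_zero, sub_zero, map_smul, ← hfe, smul_quotient_mk]

end Resolution

/-! ### Krull dimension and regular sequences -/

theorem ringKrullDim_quotient_add_le_of_isWeaklyRegular {R : Type*} [CommRing R] {I : Ideal R}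
    {a : ℕ → R} {r : ℕ}
    (h : RingTheory.Sequence.IsWeaklyRegular (R ⧸ I) (List.ofFn fun i : Fin r => a i)) {k : ℕ}
    (hk : k ≤ r) :
    ringKrullDim (R ⧸ (I ⊔ Ideal.span (a '' Set.Iio k))) + k ≤ ringKrullDim (R ⧸ I) := by
  induction k with
  | zero =>
    rw [Nat.cast_zero, add_zero]
    exact ringKrullDim_le_of_surjective _
      (Ideal.Quotient.factor_surjective (show I ≤ I ⊔ Ideal.span (a '' Set.Iio 0) from le_sup_left))
  | succ k ih =>
    refine le_trans ?_ (ih (by omega))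
    have hle : I ⊔ Ideal.span (a '' Set.Iio k) ≤ I ⊔ Ideal.span (a '' Set.Iio (k + 1)) :=
      sup_le_sup_left (Ideal.span_mono (Set.image_mono (Set.Iio_subset_Iio (by omega)))) I
    have h1 := ringKrullDim_succ_le_of_surjective (Ideal.Quotient.factor hle)
      (Ideal.Quotient.factor_surjective hle)
      (r := Ideal.Quotient.mk (I ⊔ Ideal.span (a '' Set.Iio k)) (a k)) ?_ ?_
    · rw [Nat.cast_succ, add_comm (k : WithBot ℕ∞), ← add_assoc]
      gcongr
    · rw [mem_nonZeroDivisors_iff_right]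
      intro x hx
      obtain ⟨x, rfl⟩ := Ideal.Quotient.mk_surjective x
      rw [← map_mul, Ideal.Quotient.eq_zero_iff_mem, mul_comm] at hx
      exact Ideal.Quotient.eq_zero_iff_mem.2 (mem_of_mul_mem_of_isWeaklyRegular h (by omega) hx)
    · rw [Ideal.Quotient.factor_mk, Ideal.Quotient.eq_zero_iff_mem]
      exact Ideal.mem_sup_right (Ideal.subset_span ⟨k, Nat.lt_succ_self k, rfl⟩)

/-! ### Forms of degree `d + 1` in an ideal with a Koszul tail -/

section Forms

variable {K σ : Type*} [Field K] {I : Ideal (MvPolynomial σ K)}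

theorem MinimalGradedFreeResolution.deg_ne_of_bettiTable_eq_zero
    (F : MinimalGradedFreeResolution I) {i j : ℕ} (h : F.bettiTable i j = 0) (k : Fin (F.rank i)) :
    F.deg i k ≠ i + j := fun hk => by
  rw [MinimalGradedFreeResolution.bettiTable, Finset.card_eq_zero] at h
  exact Finset.notMem_empty k (h ▸ Finset.mem_filter.2 ⟨Finset.mem_univ k, hk⟩)

theorem MinimalGradedFreeResolution.exists_deg_eq_of_bettiTable_ne_zero
    (F : MinimalGradedFreeResolution I) {i j : ℕ} (h : F.bettiTable i j ≠ 0) :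
    ∃ k, F.deg i k = i + j := by
  obtain ⟨k, hk⟩ := Finset.card_ne_zero.1 h
  exact ⟨k, (Finset.mem_filter.1 hk).2⟩

theorem HasKoszulTail.pos {B : ℕ → ℕ → ℕ} {c d : ℕ} (h : HasKoszulTail B c d) : 0 < d := by
  rcases Nat.eq_zero_or_pos d with rfl | hd
  · exact absurd (h.1.1.symm.trans h.2.2.1) one_ne_zero
  · exact hd

/-- The forms of degree `d + 1` in `I` span a space of dimension at most `c`: they are spanned by
the images of the generators of degree `d + 1`, as there are none of lower degree. -/
theorem MinimalGradedFreeResolution.exists_submodule_of_hasKoszulTail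
    (F : MinimalGradedFreeResolution I) {c d : ℕ} (hc : 1 ≤ c)
    (hF : HasKoszulTail F.bettiTable c d) :
    ∃ W : Submodule K (MvPolynomial σ K), FiniteDimensional K W ∧ Module.finrank K W ≤ c ∧
      ∀ x ∈ I, x.IsHomogeneous (d + 1) → x ∈ W := by
  classical
  obtain ⟨k₀, hk₀⟩ := F.exists_deg_eq_of_bettiTable_ne_zero (i := 0) (j := 0)
    (by rw [hF.1.1]; exact one_ne_zero)
  set D : Fin (F.rank 1) → MvPolynomial σ K := fun k => F.d 0 (Pi.single k 1) k₀ with hD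
  set s : Finset (Fin (F.rank 1)) := Finset.univ.filter fun k => F.deg 1 k = 1 + d with hs
  have hscard : s.card = c := by
    have h1 := hF.2.2.2 1 le_rfl hc
    rwa [Nat.choose_one_right] at h1
  have hDhom : ∀ k, (D k).IsHomogeneous (F.deg 1 k) := by
    intro k t ht
    have h1 := F.d_homogeneous 0 k k₀ t ht
    rw [weight_one_eq_degree]
    rw [hk₀] at h1
    exact h1
  refine ⟨Submodule.span K (s.image D : Set (MvPolynomial σ K)), inferInstance,
    (finrank_span_finset_le_card _).trans (Finset.card_image_le.trans hscard.le), ?_⟩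
  intro x hx hxd
  have hker : F.aug (x • Pi.single k₀ 1) = 0 := by
    obtain ⟨p, hp⟩ := Ideal.Quotient.mk_surjective (F.aug (Pi.single k₀ 1))
    rw [map_smul, ← hp, smul_quotient_mk, Ideal.Quotient.eq_zero_iff_mem]
    exact Ideal.mul_mem_right _ _ hx
  obtain ⟨g, hg⟩ := (F.exact_zero _).1 hker
  have hxsum : x = ∑ k, D k * g k := by
    have h1 := congrFun hg k₀
    rw [map_eq_sum_smul_single (F.d 0) g, Finset.sum_apply, Pi.smul_apply, Pi.single_eq_same,
      smul_eq_mul, mul_one] at h1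
    rw [← h1]
    refine Finset.sum_congr rfl fun k _ => ?_
    rw [Pi.smul_apply, smul_eq_mul, mul_comm]
  rw [← homogeneousComponent_eq_self hxd, hxsum, map_sum]
  refine Submodule.sum_mem _ fun k _ => ?_
  rw [homogeneousComponent_mul_left (hDhom k)]
  split_ifs with hle
  · rcases Nat.eq_zero_or_pos (F.deg 1 k) with h0 | h0
    · -- a generator of degree `0` maps to a constant, which minimality makes zero
      have h1 := hDhom k
      rw [h0] at h1
      have h2 : D k = 0 := by
        rw [← homogeneousComponent_eq_self h1, homogeneousComponent_zero]
        have h3 : coeff 0 (D k) = 0 := F.minimal 0 k k₀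
        rw [h3, map_zero]
      rw [h2, zero_mul]
      exact Submodule.zero_mem _
    · have hdeg : F.deg 1 k = 1 + d := by
        by_contra hne
        obtain ⟨j, hj⟩ := Nat.exists_eq_add_of_le h0
        refine F.deg_ne_of_bettiTable_eq_zero ?_ k hj
        rcases Nat.eq_zero_or_pos j with rfl | hj0
        · exact hF.1.2 1 le_rfl hc
        · exact hF.2.1 1 j hc hj0 (by omega)
      rw [hdeg, show d + 1 - (1 + d) = 0 by omega, homogeneousComponent_zero, mul_comm,
        ← smul_eq_C_mul]
      refine Submodule.smul_mem _ _ (Submodule.subset_span ?_)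
      exact Finset.mem_image_of_mem D (Finset.mem_filter.2 ⟨Finset.mem_univ k, hdeg⟩)
  · exact Submodule.zero_mem _

theorem exists_homogeneous_sub_mem {Q : Ideal (MvPolynomial σ K)}
    (hI : I.IsHomogeneous (homogeneousSubmodule σ K))
    (hQ : Q.IsHomogeneous (homogeneousSubmodule σ K)) {g : MvPolynomial σ K} {i : ℕ}
    (hg : g.IsHomogeneous i) (hmem : g ∈ I ⊔ Q) :
    ∃ x ∈ I, x.IsHomogeneous i ∧ g - x ∈ Q := by
  obtain ⟨x, hx, q, hq, rfl⟩ := Submodule.mem_sup.1 hmem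
  refine ⟨homogeneousComponent i x, homogeneousComponent_mem_of_mem hI hx i,
    homogeneousComponent_isHomogeneous i x, ?_⟩
  rw [← homogeneousComponent_eq_self hg, map_add, add_sub_cancel_left]
  exact homogeneousComponent_mem_of_mem hQ hq i

variable [Fintype σ]

theorem mul_linForm_mem {J : Ideal (MvPolynomial σ K)} {f : MvPolynomial σ K}
    (hf : ∀ x, X x * f ∈ J) (v : σ → K) : f * linForm K v ∈ J := by
  rw [linForm_apply, Finset.mul_sum]
  refine Ideal.sum_mem _ fun j _ => ?_
  rw [mul_smul_comm, smul_eq_C_mul, mul_comm f]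
  exact Ideal.mul_mem_left _ _ (hf j)

/-- Let `f` be a form of degree `d` that is a nonzero socle element of `S/(I + Q)`, where `Q` is
generated by a linear space `V` of linear forms. If the forms of degree `d + 1` in `I` span no more
than `codim V` dimensions, then modulo `Q` they are all of the form `f * v` with `v` linear. -/
theorem exists_sub_mul_linForm_mem (hI : I.IsHomogeneous (homogeneousSubmodule σ K))
    {V : Submodule K (σ → K)} {Q : Ideal (MvPolynomial σ K)}
    (hQ : Q = Ideal.span (linForm K '' (V : Set (σ → K)))) {d : ℕ}
    {W : Submodule K (MvPolynomial σ K)} [FiniteDimensional K W]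
    (hW : Module.finrank K W + Module.finrank K V ≤ Fintype.card σ)
    (hIW : ∀ x ∈ I, x.IsHomogeneous (d + 1) → x ∈ W)
    {f : MvPolynomial σ K} (hfd : f.IsHomogeneous d) (hfQ : f ∉ Q)
    (hf : ∀ x, X x * f ∈ I ⊔ Q) {x : MvPolynomial σ K} (hx : x ∈ I)
    (hxd : x.IsHomogeneous (d + 1)) :
    ∃ v, x - f * linForm K v ∈ Q := by
  obtain ⟨p, ψ, hker, hlin, hsub, hψker⟩ := exists_retraction V
  rw [← hQ] at hsub hψker
  have hψ : ∀ q ∈ Q, ψ q = 0 := fun q hq => RingHom.mem_ker.1 (hψker ▸ hq)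
  have hQhom : Q.IsHomogeneous (homogeneousSubmodule σ K) := by
    rw [hQ]
    refine isHomogeneous_span_of_linear ?_
    rintro _ ⟨v, -, rfl⟩
    exact isHomogeneous_linForm v
  have hψf : ψ f ≠ 0 := fun h0 => hfQ (by simpa [h0] using hsub f)
  -- `M` is the image of the forms of degree `d + 1` in `I`, and `N` that of the multiples of `f`
  set M : Submodule K (MvPolynomial σ K) :=
    (I.restrictScalars K ⊓ homogeneousSubmodule σ K (d + 1)).map ψ.toLinearMap with hM
  set mulf : (σ → K) →ₗ[K] MvPolynomial σ K := LinearMap.mulLeft K (ψ f) ∘ₗ linForm K with hmulf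
  set N : Submodule K (MvPolynomial σ K) := (LinearMap.range p).map mulf with hN
  have hMW : M ≤ W.map ψ.toLinearMap := Submodule.map_mono fun y hy => hIW y hy.1 hy.2
  have hMfin : FiniteDimensional K M := Submodule.finiteDimensional_of_le hMW
  have hMrank : Module.finrank K M ≤ Module.finrank K W :=
    (Submodule.finrank_mono hMW).trans (Submodule.finrank_map_le _ _)
  have hinj : Function.Injective mulf := by
    intro v w hvw
    exact linForm_injective (mul_left_cancel₀ hψf hvw)
  have hNrank : Module.finrank K N = Module.finrank K (LinearMap.range p) :=
    (Submodule.equivMapOfInjective mulf hinj _).finrank_eq.symm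
  have hrank := LinearMap.finrank_range_add_finrank_ker p
  rw [hker, Module.finrank_fintype_fun_eq_card] at hrank
  have hNM : N ≤ M := by
    rintro _ ⟨_, ⟨u, rfl⟩, rfl⟩
    obtain ⟨y, hy, hyd, hyq⟩ := exists_homogeneous_sub_mem hI hQhom
      (hfd.mul (isHomogeneous_linForm u)) (mul_linForm_mem hf u)
    refine ⟨y, ⟨hy, hyd⟩, ?_⟩
    have h1 := hψ _ hyq
    rw [map_sub, map_mul, hlin, sub_eq_zero] at h1
    exact h1.symm
  have hNMeq : N = M := Submodule.eq_of_le_of_finrank_le hNM (by omega)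
  have hxM : ψ x ∈ M := ⟨x, ⟨hx, hxd⟩, rfl⟩
  rw [← hNMeq] at hxM
  obtain ⟨_, ⟨v, rfl⟩, hv⟩ := hxM
  refine ⟨v, ?_⟩
  have h1 : ψ (x - f * linForm K v) = 0 := by
    rw [map_sub, map_mul, hlin, ← hv]
    exact sub_self _
  simpa [h1] using hsub (x - f * linForm K v)

end Forms

/-! ### Forms that are not multiples of a given form -/

theorem exists_dual_pair {K E : Type*} [Field K] [AddCommGroup E] [Module K E]
    [FiniteDimensional K E] (U : Submodule K E)
    (hU : Module.finrank K U + 2 ≤ Module.finrank K E) :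
    ∃ (α β : E →ₗ[K] K) (u v : E), (∀ x ∈ U, α x = 0 ∧ β x = 0) ∧
      α u = 1 ∧ β u = 0 ∧ α v = 0 ∧ β v = 1 := by
  have h1 := U.finrank_quotient_add_finrank
  set b := Module.finBasis K (E ⧸ U)
  obtain ⟨u, hu⟩ := U.mkQ_surjective (b ⟨0, by omega⟩)
  obtain ⟨v, hv⟩ := U.mkQ_surjective (b ⟨1, by omega⟩)
  refine ⟨b.coord ⟨0, by omega⟩ ∘ₗ U.mkQ, b.coord ⟨1, by omega⟩ ∘ₗ U.mkQ, u, v, ?_, ?_⟩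
  · intro x hx
    have : U.mkQ x = 0 := by simpa using hx
    simp only [LinearMap.comp_apply, this, map_zero, and_self]
  · simp only [LinearMap.comp_apply, hu, hv, Module.Basis.coord_apply, Module.Basis.repr_self]
    simp

/-- In at least two variables modulo the linear forms in `U`, the forms of degree `d + 1` are not
all products of a fixed `f` with linear forms modulo `U`, if `d > 0`. The proof restricts to a line,
that is, to polynomials in one variable: `1` being a multiple of the restriction `h` of `f` makes `h`
constant, and then `X ^ 2` is not the product of `h` and the restriction of a linear form. -/
theorem exists_form_notMem_of_two_le_codim {K σ : Type*} [Field K] [Fintype σ]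
    {U : Submodule K (σ → K)} (hU : Module.finrank K U + 2 ≤ Fintype.card σ) {d : ℕ} (hd : 0 < d)
    (f : MvPolynomial σ K) :
    ∃ g : MvPolynomial σ K, g.IsHomogeneous (d + 1) ∧
      ∀ v, g - f * linForm K v ∉ Ideal.span (linForm K '' (U : Set (σ → K))) := by
  classical
  obtain ⟨α, β, u₁, u₂, hαβ, hα1, hβ1, hα2, hβ2⟩ := exists_dual_pair U (by simpa using hU)
  set φ : MvPolynomial σ K →ₐ[K] Polynomial K :=
    aeval fun j => Polynomial.C (α (Pi.single j 1)) + Polynomial.C (β (Pi.single j 1)) * Polynomial.X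
    with hφ
  have hφlin : ∀ v, φ (linForm K v) = Polynomial.C (α v) + Polynomial.C (β v) * Polynomial.X := by
    intro v
    have hv : ∀ γ : (σ → K) →ₗ[K] K, γ v = ∑ j, v j * γ (Pi.single j 1) := fun γ =>
      map_eq_sum_smul_single γ v
    rw [hφ, aeval_linForm, hv α, hv β, map_sum, map_sum, Finset.sum_mul,
      ← Finset.sum_add_distrib]
    refine Finset.sum_congr rfl fun j _ => ?_
    rw [Polynomial.smul_eq_C_mul, Polynomial.C_mul, Polynomial.C_mul]
    ring
  have hφU : Ideal.span (linForm K '' (U : Set (σ → K))) ≤ RingHom.ker φ := by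
    rw [Ideal.span_le]
    rintro _ ⟨v, hv, rfl⟩
    simp [RingHom.mem_ker, hφlin, hαβ v hv]
  by_contra! hcon
  have key : ∀ g : MvPolynomial σ K, g.IsHomogeneous (d + 1) →
      ∃ a b : K, φ g = φ f * (Polynomial.C a + Polynomial.C b * Polynomial.X) := by
    intro g hg
    obtain ⟨v, hv⟩ := hcon g hg
    have h1 := RingHom.mem_ker.1 (hφU hv)
    rw [map_sub, map_mul, hφlin, sub_eq_zero] at h1
    exact ⟨_, _, h1⟩
  have hhom := isHomogeneous_linForm (K := K) (σ := σ)
  obtain ⟨a, b, hab⟩ := key (linForm K u₁ ^ (d + 1)) (by simpa using (hhom u₁).pow (d + 1))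
  obtain ⟨a', b', hab'⟩ := key (linForm K u₁ ^ (d - 1) * linForm K u₂ ^ 2) (by
    have h1 := ((hhom u₁).pow (d - 1)).mul ((hhom u₂).pow 2)
    convert h1 using 1
    omega)
  simp only [map_pow, map_mul, hφlin, hα1, hβ1, hα2, hβ2, map_one, map_zero, zero_mul, add_zero,
    one_pow, one_mul, zero_add] at hab hab'
  obtain ⟨r, -, hr⟩ := Polynomial.isUnit_iff.1 (IsUnit.of_mul_eq_one _ hab.symm)
  rw [← hr] at hab'
  have h2 := congrArg (fun q => Polynomial.coeff q 2) hab'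
  simp only [Polynomial.coeff_C_mul, Polynomial.coeff_add, Polynomial.coeff_C_succ,
    Polynomial.coeff_X_of_ne_one (by decide : (2 : ℕ) ≠ 1), Polynomial.coeff_X_pow_self, mul_zero,
    add_zero] at h2
  exact one_ne_zero h2

/-! ### Failure of the weak Lefschetz property -/

theorem corollary1 {K : Type*} [Field K] (n m d : ℕ) (hnm : m + 3 ≤ n)
    (I : Ideal (MvPolynomial (Fin (n + 1)) K))
    (hI : I.IsHomogeneous (homogeneousSubmodule (Fin (n + 1)) K))
    (hCM : IsCohenMacaulay (MvPolynomial (Fin (n + 1)) K ⧸ I))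
    (hdim : ringKrullDim (MvPolynomial (Fin (n + 1)) K ⧸ I) = ((m + 1 : ℕ) : WithBot ℕ∞))
    (F : MinimalGradedFreeResolution I) (hF : HasKoszulTail F.bettiTable (n - m) d)
    (l : Fin (m + 1) → MvPolynomial (Fin (n + 1)) K) (hl : ∀ i, (l i).IsHomogeneous 1)
    (hreg : RingTheory.Sequence.IsRegular (MvPolynomial (Fin (n + 1)) K ⧸ I) (List.ofFn l)) :
    IsArtinianRing (MvPolynomial (Fin (n + 1)) K ⧸ (I ⊔ Ideal.span (Set.range l))) ∧
      ¬ HasWLP (I ⊔ Ideal.span (Set.range l)) := by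
  choose w₀ hw₀ using fun i => exists_linForm_eq (hl i)
  set w₁ : ℕ → Fin (n + 1) → K := fun k => if h : k < m + 1 then w₀ ⟨k, h⟩ else 0 with hw₁
  have hlw₁ : l = fun i : Fin (m + 1) => linForm K (w₁ i) := by
    ext1 i
    simp only [hw₁, dif_pos i.2, Fin.eta, hw₀]
  obtain ⟨w, hww₁, hwind⟩ := exists_linearIndependent_extension (K := K) (N := n + 1)
    (by omega) (by simp) w₁ (linearIndependent_of_isRegular w₁ (hlw₁ ▸ hreg) le_rfl)
  set a : ℕ → MvPolynomial (Fin (n + 1)) K := fun k => linForm K (w k) with ha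
  have hla : l = fun i : Fin (m + 1) => a i := by
    rw [hlw₁]
    ext1 i
    rw [ha]
    simp only [hww₁ i i.2]
  rw [hla] at hreg
  have hrange : Set.range l = a '' Set.Iio (m + 1) := by
    rw [hla]
    ext x
    constructor
    · rintro ⟨i, rfl⟩
      exact ⟨i, i.2, rfl⟩
    · rintro ⟨i, hi, rfl⟩
      exact ⟨⟨i, hi⟩, rfl⟩
  rw [hrange]
  clear hrange hla hl hlw₁ hww₁ hw₁ hw₀ l
  constructor
  · rw [isArtinianRing_iff_krullDimLE_zero, Ring.KrullDimLE, Order.krullDimLE_iff]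
    have h1 := ringKrullDim_quotient_add_le_of_isWeaklyRegular hreg.toIsWeaklyRegular le_rfl
    rw [hdim] at h1
    exact (ENat.WithBot.add_le_add_natCast_right_iff (c := m + 1)).1 (h1.trans (zero_add _).ge)
  · rintro ⟨ℓ, hℓ, hfull⟩
    obtain ⟨u, rfl⟩ := exists_linForm_eq hℓ
    obtain ⟨k₀, hk₀⟩ := F.exists_deg_eq_of_bettiTable_ne_zero (i := n - m) (j := d) (by
      rw [hF.2.2.2 _ (by omega) le_rfl, Nat.choose_self]
      exact one_ne_zero)
    have hsum : m + 1 + (n - m) = n + 1 := by omega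
    obtain ⟨f, hfd, hfJ, hfX⟩ := F.exists_socle_form (a := a) (r := m + 1) (c := n - m) (d := d)
      (fun k _ => isHomogeneous_linForm _)
      (fun k hk g hg => mem_of_mul_mem_of_linearIndependent hwind (by omega) hg)
      (fun k hk g hg => mem_of_mul_mem_of_isWeaklyRegular hreg.toIsWeaklyRegular hk hg)
      (fun x => by
        rw [hsum]
        have h1 := X_mem_span_of_linearIndependent (K := K) (σ := Fin (n + 1)) (w := w)
        rw [Fintype.card_fin] at h1
        exact h1 hwind x) k₀ hk₀
    set Q := Ideal.span (a '' Set.Iio (m + 1)) with hQ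
    rcases hfull d with hinj | hsurj
    · -- injectivity fails, as `f` is a nonzero element of the socle
      refine hfJ (Ideal.Quotient.eq_zero_iff_mem.1 ?_)
      refine hinj (x₁ := Ideal.Quotient.mk _ f) ⟨f, hfd, rfl⟩ (Submodule.zero_mem _) ?_
      simp only [mul_zero]
      rw [← map_mul, Ideal.Quotient.eq_zero_iff_mem, mul_comm]
      exact mul_linForm_mem hfX u
    · -- surjectivity fails, as `I` has too few forms of degree `d + 1`
      set V := Submodule.span K (w '' Set.Iio (m + 1)) with hV
      have hQV : Q = Ideal.span (linForm K '' (V : Set (Fin (n + 1) → K))) := by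
        rw [hV, span_linForm_image, Set.image_image]
      have hVrank : Module.finrank K V ≤ m + 1 := by
        classical
        have h1 := (finrank_span_finset_le_card (R := K) ((Finset.range (m + 1)).image w)).trans
          Finset.card_image_le
        rwa [Finset.coe_image, Finset.coe_range, Finset.card_range] at h1
      have hQhom : Q.IsHomogeneous (homogeneousSubmodule (Fin (n + 1)) K) := by
        refine isHomogeneous_span_of_linear ?_
        rintro _ ⟨k, -, rfl⟩
        exact isHomogeneous_linForm _
      obtain ⟨W, hWfin, hWrank, hIW⟩ := F.exists_submodule_of_hasKoszulTail (by omega) hF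
      have hUrank : Module.finrank K ↥(V ⊔ Submodule.span K {u}) ≤ m + 2 := by
        have h1 := Submodule.finrank_add_le_finrank_add_finrank V (Submodule.span K {u})
        have h2 := finrank_span_finset_le_card (R := K) ({u} : Finset (Fin (n + 1) → K))
        rw [Finset.coe_singleton, Finset.card_singleton, Set.finrank] at h2
        omega
      obtain ⟨g, hgd, hg⟩ := exists_form_notMem_of_two_le_codim
        (U := V ⊔ Submodule.span K {u}) (by rw [Fintype.card_fin]; omega) hF.pos f
      obtain ⟨_, ⟨s, hs, rfl⟩, hsg⟩ :=
        hsurj (show Ideal.Quotient.mk (I ⊔ Q) g ∈ gradedPiece (I ⊔ Q) (d + 1) from ⟨g, hgd, rfl⟩)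
      replace hsg : Ideal.Quotient.mk (I ⊔ Q) (linForm K u) * Ideal.Quotient.mk (I ⊔ Q) s =
        Ideal.Quotient.mk (I ⊔ Q) g := hsg
      rw [← map_mul, eq_comm, Ideal.Quotient.mk_eq_mk_iff_sub_mem] at hsg
      obtain ⟨x, hx, hxd, hxq⟩ := exists_homogeneous_sub_mem hI hQhom (i := d + 1)
        (hgd.sub (by simpa [add_comm] using (isHomogeneous_linForm u).mul hs)) hsg
      obtain ⟨v, hv⟩ := exists_sub_mul_linForm_mem hI hQV (by rw [Fintype.card_fin]; omega) hIW hfd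
        (fun h => hfJ (Ideal.mem_sup_right h)) hfX hx hxd
      refine hg v ?_
      have hle : Q ≤ Ideal.span (linForm K '' ((V ⊔ Submodule.span K {u} :
          Submodule K (Fin (n + 1) → K)) : Set (Fin (n + 1) → K))) := by
        rw [hQV]
        exact Ideal.span_mono (Set.image_mono (SetLike.coe_subset_coe.2 le_sup_left))
      have hu : linForm K u ∈ Ideal.span (linForm K '' ((V ⊔ Submodule.span K {u} :
          Submodule K (Fin (n + 1) → K)) : Set (Fin (n + 1) → K))) :=
        Ideal.subset_span ⟨u, Submodule.mem_sup_right (Submodule.mem_span_singleton_self u), rfl⟩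
      have h3 := Ideal.add_mem _ (hle (Ideal.add_mem _ hxq hv)) (Ideal.mul_mem_right s _ hu)
      convert h3 using 1
      ring
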